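/- **Setting.** Let $H$, $U$, $\bar U$ be real separable Hilbert spaces, $U$ infinite-dimensional with a fixed orthonormal basis $(e_k)_{k\in\mathbb N}$, and let $J:U\to\bar U$ be a fixed one-to-one Hilbert–Schmidt operator. Let $V,E$ be real separable Banach spaces with $V\subseteq H\subseteq E$ continuously and densely; put $\|x\|_V:=\infty$ for $x\in H\setminus V$. Let $$\mathbb B:=\Big\{\omega\in C(\mathbb R_+;H)\ \Big|\ \int_0^T\|\omega(s)\|_V\,ds<\infty\ \text{ for all } T\ge 0\Big\},$$ $$\rho(\omega_1,\omega_2):=\sum_{k\ge1}2^{-k}\Big[\Big(\int_0^k\|\omega_2(s)-\omega_1(s)\|_V\,ds+\sup_{t\le k}\|\omega_2(t)-\omega_1(t)\|_H\Big)\wedge1\Big],$$ with the Borel $\sigma$-algebra $\mathcal B(\mathbb B)$ of $\rho$ and $\mathcal B_t(\mathbb B):=\sigma(\omega\mapsto\omega(s)\mid s\le t)$. Let $\mathbb W_0:=\{w\in C(\mathbb R_+;\bar U)\mid w(0)=0\}$ with locally uniform convergence, its Borel $\sigma$-algebra, and $\mathcal B_t(\mathbb W_0):=\sigma(w\mapsto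 w(s)\mid s\le t)$. Let $L_2(U,H)$ be the space of Hilbert–Schmidt operators, and let $b:\mathbb R_+\times\mathbb B\to E$ and $\sigma:\mathbb R_+\times\mathbb B\to L_2(U,H)$ be jointly Borel measurable, with $b(t,\cdot)$ and $\sigma(t,\cdot)$ $\mathcal B_t(\mathbb B)$-measurable for every $t\ge0$. Consider $$X_t=X_0+\int_0^t b(s,X)\,ds+\int_0^t\sigma(s,X)\,dW_s,\qquad t\ge0. \tag{1}$$ A *stochastic basis* is a complete probability space $(\Omega,\mathcal F,\mathbb P)$ with a right-continuous filtration $(\mathcal F_t)_{t\ge0}$ such that $\mathcal F_0$ contains all null sets. A *standard $(\mathcal F_t)$-$\mathbb R^\infty$-Wiener process* is a family $W=(\beta_k)_{k\in\mathbb N}$ of independent real-valued Brownian motions, adapted to $(\mathcal F_t)$, such that $W_t-W_s$ is independent of $\mathcal F_s$ for all $s\le t$; $\bar W_t:=\sum_k\beta_k(t)Je_k$ is the associated process with paths in $\mathbb W_0$, and $\mathbb P^{\bar Q}$ denotes its law on $\mathbb W_0$. The stochastic integral is $\int_0^t\sigma(s,X)\,dW_s:=\int_0^t\sigma(s,X)\circ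 J^{-1}\,d\bar W_s$. A *weak solution* is a pair $(X,W)$ on some stochastic basis, where $X$ is adapted with paths in $\mathbb B$ and $W$ is a standard $\mathbb R^\infty$-Wiener process, such that $\int_0^T\|b(s,X)\|_E\,ds+\int_0^T\|\sigma(s,X)\|_{L_2(U,H)}^2\,ds<\infty$ a.s. for all $T\ge 0$, and a.s. (1) holds in $E$ for all $t\ge0$. *Joint uniqueness in law* holds if any two weak solutions $(X,W^1)$, $(Y,W^2)$, on possibly different stochastic bases, for which $X_0$ and $Y_0$ have the same law, satisfy $\mathrm{Law}(X,\bar W^1)=\mathrm{Law}(Y,\bar W^2)$ on $\mathcal B(\mathbb B)\otimes\mathcal B(\mathbb W_0)$. *Pathwise uniqueness* holds if for any two weak solutions $(X,W)$, $(Y,W)$ on the same stochastic basis with the same $W$, $X_0=Y_0$ a.s. implies that a.s. $X_t=Y_t$ for all $t\ge0$. These properties hold *given $\mu$*, for a Borel probability measure $\mu$ on $H$, if they hold for all such weak solutions whose initial values both have law $\mu$. Equation (1) has a *strong solution* if there are a map $F:H\times\mathbb W_0\to\mathbb B$ and, for each Borel probability measure $\mu$ on $H$, a map $F_\mu:H\times\mathbb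 W_0\to\mathbb B$ that is Borel measurable with respect to the completion of $\mathcal B(H)\otimes\mathcal B(\mathbb W_0)$ under $\mu\otimes\mathbb P^{\bar Q}$, such that 1. for $\mu$-a.e. $h$, $F(h,w)=F_\mu(h,w)$ for $\mathbb P^{\bar Q}$-a.e. $w$; 2. for all $h\in H$ and $t\ge0$, $F(h,\cdot)$ is measurable from the $\mathbb P^{\bar Q}$-completion of $\mathcal B_t(\mathbb W_0)$ to $\mathcal B_t(\mathbb B)$; 3. for every standard $\mathbb R^\infty$-Wiener process $W$ on any stochastic basis and every $\mathcal F_0$-measurable $\xi:\Omega\to H$, the process $X:=F_{\mathbb P\circ\xi^{-1}}(\xi,\bar W)$ is such that $(X,W)$ is a weak solution with $X_0=\xi$ a.s. **Theorem 1.** Suppose that equation (1) has a strong solution. If joint uniqueness in law given $\mu$ holds for some Borel probability measure $\mu$ on $H$, then pathwise uniqueness given $\mu$ holds. In particular, the existence of a strong solution together with joint uniqueness in law implies pathwise uniqueness. -/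

import Mathlib

open MeasureTheory ProbabilityTheory Filter Topology
open scoped NNReal ENNReal

universe u

/-! ### Hilbert-Schmidt operators -/

section HilbertSchmidtOperators

variable {U H : Type*} [NormedAddCommGroup U] [InnerProductSpace ℝ U]
  [NormedAddCommGroup H] [InnerProductSpace ℝ H]

/-- The squared Hilbert-Schmidt norm `∑ₖ ‖A eₖ‖²` (possibly infinite) of a bounded operator. -/
noncomputable def hsNormSq (e : HilbertBasis ℕ ℝ U) (A : U →L[ℝ] H) : ℝ≥0∞ :=
  ∑' k, ‖A (e k)‖ₑ ^ 2

/-- The linear space of Hilbert-Schmidt operators from `U` to `H`. -/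
def hsSubmodule (H : Type*) [NormedAddCommGroup H] [InnerProductSpace ℝ H]
    (e : HilbertBasis ℕ ℝ U) : Submodule ℝ (U →L[ℝ] H) where
  carrier := {A | Memℓp (fun k => A (e k)) 2}
  zero_mem' := by
    change Memℓp (fun k => (0 : H)) 2
    exact zero_memℓp
  add_mem' := fun ha hb => ha.add hb
  smul_mem' := fun c _ ha => ha.const_smul c

/-- The space `L₂(U, H)` of Hilbert-Schmidt operators. It is a type of its own, so that it carries
the Hilbert-Schmidt norm and not the operator norm. -/
def HilbertSchmidt (H : Type*) [NormedAddCommGroup H] [InnerProductSpace ℝ H]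
    (e : HilbertBasis ℕ ℝ U) : Type _ := hsSubmodule H e

namespace HilbertSchmidt

variable {e : HilbertBasis ℕ ℝ U}

instance : AddCommGroup (HilbertSchmidt H e) := inferInstanceAs (AddCommGroup (hsSubmodule H e))

instance : Module ℝ (HilbertSchmidt H e) := inferInstanceAs (Module ℝ (hsSubmodule H e))

/-- The underlying bounded operator. -/
def toCLM (A : HilbertSchmidt H e) : U →L[ℝ] H := Subtype.val A

/-- The isometric embedding `A ↦ (A eₖ)ₖ` into `ℓ²(ℕ, H)`. -/
noncomputable def toLp : HilbertSchmidt H e →ₗ[ℝ] lp (fun _ : ℕ => H) 2 where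
  toFun A := ⟨fun k => A.toCLM (e k), A.2⟩
  map_add' _ _ := rfl
  map_smul' _ _ := rfl

theorem toLp_injective : Function.Injective (toLp (H := H) (e := e)) := by
  intro A B h
  have h1 : ∀ k, A.toCLM (e k) = B.toCLM (e k) := fun k =>
    congrFun (congrArg Subtype.val h) k
  have h2 : A.toCLM = B.toCLM := by
    apply ContinuousLinearMap.ext_on (s := Set.range e)
    · rw [dense_iff_closure_eq, ← Submodule.topologicalClosure_coe, e.dense_span]
      rfl
    · rintro _ ⟨k, rfl⟩
      exact h1 k
  exact Subtype.ext h2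

/-- The Hilbert-Schmidt norm `‖A‖ = (∑ₖ ‖A eₖ‖²)^(1/2)`. -/
noncomputable instance : NormedAddCommGroup (HilbertSchmidt H e) :=
  NormedAddCommGroup.induced _ _ (toLp (H := H) (e := e)) toLp_injective

noncomputable instance : NormedSpace ℝ (HilbertSchmidt H e) :=
  NormedSpace.induced ℝ _ _ (toLp (H := H) (e := e))

/-- The Borel σ-algebra of `L₂(U, H)`. -/
noncomputable instance : MeasurableSpace (HilbertSchmidt H e) := borel _

instance : BorelSpace (HilbertSchmidt H e) := ⟨rfl⟩

end HilbertSchmidt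

end HilbertSchmidtOperators

/-! ### Path spaces -/

/-- Lebesgue measure on `ℝ₊ = [0, ∞)`. -/
noncomputable def lebesgueNN : Measure ℝ≥0 := Measure.comap ((↑) : ℝ≥0 → ℝ) volume

section PathSpaces

variable {V H E Ubar : Type*}
  [NormedAddCommGroup V] [NormedSpace ℝ V]
  [NormedAddCommGroup H] [InnerProductSpace ℝ H]
  [NormedAddCommGroup E] [NormedSpace ℝ E]
  [NormedAddCommGroup Ubar] [InnerProductSpace ℝ Ubar]

/-- `i : V → H` and `j : H → E` realize continuous and dense inclusions `V ⊆ H ⊆ E`. -/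
structure IsGelfandTriple (i : V →L[ℝ] H) (j : H →L[ℝ] E) : Prop where
  injective_left : Function.Injective i
  denseRange_left : DenseRange i
  injective_right : Function.Injective j
  denseRange_right : DenseRange j

/-- The norm of `V`, extended to `H` by `∞` outside of `V`. -/
noncomputable def vNorm (i : V →L[ℝ] H) (x : H) : ℝ≥0∞ := ⨅ (v : V) (_ : i v = x), ‖v‖ₑ

/-- The path space `𝔹` of all continuous `ω : ℝ₊ → H` such that `∫₀ᵀ ‖ω(s)‖_V ds < ∞` for all
`T`. -/
def PathSpace (i : V →L[ℝ] H) : Type _ :=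
  {ω : C(ℝ≥0, H) // ∀ T : ℝ≥0, ∫⁻ s in Set.Iic T, vNorm i (ω s) ∂lebesgueNN < ∞}

namespace PathSpace

variable {i : V →L[ℝ] H}

instance : CoeFun (PathSpace i) (fun _ => ℝ≥0 → H) := ⟨fun ω => ω.1⟩

/-- The metric
`ρ(x, y) = ∑_{k ≥ 1} 2⁻ᵏ ((∫₀ᵏ ‖y(s) - x(s)‖_V ds + sup_{t ≤ k} ‖y(t) - x(t)‖_H) ∧ 1)`. -/
noncomputable def rho (x y : PathSpace i) : ℝ≥0∞ :=
  ∑' k : ℕ, (2 : ℝ≥0∞)⁻¹ ^ (k + 1) *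
    min ((∫⁻ s in Set.Iic ((k : ℝ≥0) + 1), vNorm i (y s - x s) ∂lebesgueNN) +
      ⨆ t ∈ Set.Iic ((k : ℝ≥0) + 1), ‖y t - x t‖ₑ) 1

/-- The topology of the metric `ρ`. -/
instance : TopologicalSpace (PathSpace i) where
  IsOpen S := ∀ x ∈ S, ∃ ε : ℝ≥0∞, 0 < ε ∧ ∀ y, rho x y < ε → y ∈ S
  isOpen_univ := fun _ _ => ⟨1, one_pos, fun _ _ => trivial⟩
  isOpen_inter := by
    rintro S T hS hT x ⟨hxS, hxT⟩
    obtain ⟨a, ha, ha'⟩ := hS x hxS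
    obtain ⟨b, hb, hb'⟩ := hT x hxT
    exact ⟨min a b, lt_min ha hb, fun y hy =>
      ⟨ha' y (hy.trans_le (min_le_left _ _)), hb' y (hy.trans_le (min_le_right _ _))⟩⟩
  isOpen_sUnion := by
    rintro F hF x ⟨S, hS, hx⟩
    obtain ⟨a, ha, ha'⟩ := hF S hS x hx
    exact ⟨a, ha, fun y hy => ⟨S, hS, ha' y hy⟩⟩

/-- The Borel σ-algebra of `(𝔹, ρ)`. -/
instance : MeasurableSpace (PathSpace i) := borel _

instance : BorelSpace (PathSpace i) := ⟨rfl⟩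

/-- The σ-algebra on `𝔹` generated by the evaluations at the times `s ≤ t`. -/
@[reducible] def upTo (i : V →L[ℝ] H) [MeasurableSpace H] (t : ℝ≥0) : MeasurableSpace (PathSpace i) :=
  ⨆ s ∈ Set.Iic t, MeasurableSpace.comap (fun ω : PathSpace i => ω s) inferInstance

end PathSpace

/-- The space `𝕎₀` of continuous `w : ℝ₊ → Ubar` with `w(0) = 0`. It carries the topology of
locally uniform convergence. -/
def WienerSpace (Ubar : Type*) [NormedAddCommGroup Ubar] : Type _ :=
  {w : C(ℝ≥0, Ubar) // w 0 = 0}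

namespace WienerSpace

instance : CoeFun (WienerSpace Ubar) (fun _ => ℝ≥0 → Ubar) := ⟨fun w => w.1⟩

instance : TopologicalSpace (WienerSpace Ubar) :=
  inferInstanceAs (TopologicalSpace {w : C(ℝ≥0, Ubar) // w 0 = 0})

/-- The Borel σ-algebra of `𝕎₀`. -/
instance : MeasurableSpace (WienerSpace Ubar) := borel _

instance : BorelSpace (WienerSpace Ubar) := ⟨rfl⟩

/-- The σ-algebra on `𝕎₀` generated by the evaluations at the times `s ≤ t`. -/
@[reducible] def upTo (Ubar : Type*) [NormedAddCommGroup Ubar] [MeasurableSpace Ubar] (t : ℝ≥0) :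
    MeasurableSpace (WienerSpace Ubar) :=
  ⨆ s ∈ Set.Iic t, MeasurableSpace.comap (fun w : WienerSpace Ubar => w s) inferInstance

end WienerSpace

end PathSpaces

/-! ### Stochastic bases and Wiener processes -/

section Wiener

variable {U H Ubar : Type*}
  [NormedAddCommGroup U] [InnerProductSpace ℝ U]
  [NormedAddCommGroup H] [InnerProductSpace ℝ H]
  [NormedAddCommGroup Ubar] [InnerProductSpace ℝ Ubar]

/-- `(Ω, 𝓕, (𝓕ₜ), P)` is a stochastic basis: `P` is a complete probability measure, the filtration
is right-continuous and `𝓕₀` contains all null sets. -/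
structure IsStochasticBasis {Ω : Type u} {mΩ : MeasurableSpace Ω} (𝓕 : Filtration ℝ≥0 mΩ)
    (P : Measure Ω) : Prop where
  isProbabilityMeasure : IsProbabilityMeasure P
  isComplete : P.IsComplete
  isRightContinuous : 𝓕.IsRightContinuous
  measurableSet_of_null : ∀ N : Set Ω, P N = 0 → MeasurableSet[𝓕 0] N

/-- A standard `(𝓕ₜ)`-`ℝ^∞`-Wiener process `W = (βₖ)ₖ` with respect to the orthonormal basis `e`
of `U`, together with its associated cylindrical Wiener process `W̄ₜ = ∑ₖ βₖ(t) J eₖ`, a random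
variable with values in `𝕎₀`. The series converges almost surely for every `t` (in general not
unconditionally), so that `W̄` is determined by `W` up to indistinguishability. -/
structure WienerProcess (e : HilbertBasis ℕ ℝ U) (J : U →L[ℝ] Ubar)
    {Ω : Type u} {mΩ : MeasurableSpace Ω} (𝓕 : Filtration ℝ≥0 mΩ) (P : Measure Ω) where
  /-- the coordinate processes `βₖ` -/
  coord : ℕ → ℝ≥0 → Ω → ℝ
  /-- the associated process `W̄` -/
  bar : Ω → WienerSpace Ubar
  adapted : ∀ k t, Measurable[𝓕 t] (coord k t)
  isBrownian : ∀ k, IsBrownianReal (coord k) P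
  iIndepFun_coord : iIndepFun (fun k ω t => coord k t ω) P
  indep_increments : ∀ s t : ℝ≥0, s ≤ t →
    Indep (MeasurableSpace.comap (fun ω k => coord k t ω - coord k s ω) inferInstance) (𝓕 s) P
  tendsto_bar : ∀ t, ∀ᵐ ω ∂P,
    Tendsto (fun n => ∑ k ∈ Finset.range n, coord k t ω • J (e k)) atTop (𝓝 (bar ω t))

/-- `ν` is the law `P^Q̄` on `𝕎₀` of the cylindrical Wiener process `W̄`. -/
def IsWienerLaw (e : HilbertBasis ℕ ℝ U) (J : U →L[ℝ] Ubar)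
    (ν : Measure (WienerSpace Ubar)) : Prop :=
  ∃ (Ω : Type u) (mΩ : MeasurableSpace Ω) (𝓕 : Filtration ℝ≥0 mΩ) (P : Measure Ω)
    (W : WienerProcess e J 𝓕 P), IsStochasticBasis 𝓕 P ∧ ν = P.map W.bar

/-! ### The stochastic integral -/

/-- An elementary process `∑ₖ φₖ 1_{]tₖ, tₖ₊₁]}` on `[0, T]`, where `0 = t₀ < ⋯ < tₙ = T` and
`φₖ : Ω → L(Ubar, H)` takes finitely many values and is `𝓕_{tₖ}`-measurable with respect to the
strong Borel σ-algebra, which is generated by the evaluations at the vectors of `Ubar`. -/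
structure ElementaryProcess (Ubar H : Type*) [NormedAddCommGroup Ubar] [InnerProductSpace ℝ Ubar]
    [NormedAddCommGroup H] [InnerProductSpace ℝ H] [MeasurableSpace H]
    {Ω : Type u} {mΩ : MeasurableSpace Ω} (𝓕 : Filtration ℝ≥0 mΩ) (T : ℝ≥0) where
  /-- the number of intervals -/
  n : ℕ
  /-- the partition points `tₖ` -/
  time : Fin (n + 1) → ℝ≥0
  /-- the random operators `φₖ` -/
  op : Fin n → Ω → Ubar →L[ℝ] H
  strictMono_time : StrictMono time
  time_zero : time 0 = 0
  time_last : time (Fin.last n) = T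
  finite_range : ∀ k, (Set.range (op k)).Finite
  measurable_op : ∀ k u, Measurable[𝓕 (time k.castSucc)] (fun ω => op k ω u)

namespace ElementaryProcess

variable [MeasurableSpace H] {Ω : Type u} {mΩ : MeasurableSpace Ω} {𝓕 : Filtration ℝ≥0 mΩ}
  {T : ℝ≥0}

/-- The value of an elementary process at time `s`. -/
noncomputable def value (A : ElementaryProcess Ubar H 𝓕 T) (s : ℝ≥0) (ω : Ω) : Ubar →L[ℝ] H :=
  ∑ k, (Set.Ioc (A.time k.castSucc) (A.time k.succ)).indicator (fun _ => A.op k ω) s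

/-- The stochastic integral `∑ₖ φₖ (w(tₖ₊₁ ∧ t) - w(tₖ ∧ t))` of an elementary process. -/
noncomputable def integral (A : ElementaryProcess Ubar H 𝓕 T) (w : Ω → WienerSpace Ubar)
    (t : ℝ≥0) (ω : Ω) : H :=
  ∑ k, A.op k ω (w ω (min (A.time k.succ) t) - w ω (min (A.time k.castSucc) t))

end ElementaryProcess

variable [MeasurableSpace H] {e : HilbertBasis ℕ ℝ U} {J : U →L[ℝ] Ubar}
  {Ω : Type u} {mΩ : MeasurableSpace Ω} {𝓕 : Filtration ℝ≥0 mΩ} {P : Measure Ω}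

/-- The continuous adapted process `I` is, on `[0, T]`, the stochastic integral
`∫₀ᵗ Φ(s) dWₛ = ∫₀ᵗ Φ(s) ∘ J⁻¹ dW̄ₛ` of the square-integrable integrand `Φ`: it is the limit of
integrals of elementary processes `Aₙ` with `E ∫₀ᵀ ‖Φ(s) - Aₙ(s) ∘ J‖²_{L₂(U, H)} ds → 0`. -/
def IsItoIntegralOn (W : WienerProcess e J 𝓕 P) (T : ℝ≥0) (Φ : ℝ≥0 → Ω → U →L[ℝ] H)
    (I : ℝ≥0 → Ω → H) : Prop :=
  (∀ t, Measurable[𝓕 t] (I t)) ∧ (∀ ω, Continuous (fun t => I t ω)) ∧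
  ∃ A : ℕ → ElementaryProcess Ubar H 𝓕 T,
    Tendsto (fun n => ∫⁻ ω, ∫⁻ s in Set.Iic T, hsNormSq e (Φ s ω - ((A n).value s ω).comp J) ∂lebesgueNN ∂P)
      atTop (𝓝 0) ∧
    ∀ t ≤ T, Tendsto (fun n => ∫⁻ ω, ‖I t ω - (A n).integral W.bar t ω‖ₑ ^ 2 ∂P) atTop (𝓝 0)

open Classical in
/-- The process `I` is the stochastic integral `∫₀ᵗ Φ(s) dWₛ`, `t ≥ 0`, obtained by localization:
`Iₜ = limₙ ∫₀ᵗ 1_{]0, τₙ]}(s) Φ(s) dWₛ` for stopping times `τₙ ↑ ∞` such that the integrands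
`1_{]0, τₙ]} Φ` are square-integrable on bounded time intervals. -/
def IsStochasticIntegral (W : WienerProcess e J 𝓕 P) (Φ : ℝ≥0 → Ω → U →L[ℝ] H)
    (I : ℝ≥0 → Ω → H) : Prop :=
  ∃ (τ : ℕ → Ω → WithTop ℝ≥0) (Iloc : ℕ → ℝ≥0 → Ω → H),
    IsLocalizingSequence 𝓕 τ P ∧
    (∀ n T, 0 < T → IsItoIntegralOn W T
      (fun s ω => if 0 < s ∧ (s : WithTop ℝ≥0) ≤ τ n ω then Φ s ω else 0) (Iloc n)) ∧
    ∀ᵐ ω ∂P, ∀ t, Tendsto (fun n => Iloc n t ω) atTop (𝓝 (I t ω))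

end Wiener

/-! ### The stochastic differential equation `dXₜ = b(t, X) dt + σ(t, X) dWₜ` -/

section Equation

variable {V H E U Ubar : Type*}
  [NormedAddCommGroup V] [NormedSpace ℝ V]
  [NormedAddCommGroup H] [InnerProductSpace ℝ H] [MeasurableSpace H]
  [NormedAddCommGroup E] [NormedSpace ℝ E]
  [NormedAddCommGroup U] [InnerProductSpace ℝ U]
  [NormedAddCommGroup Ubar] [InnerProductSpace ℝ Ubar] [MeasurableSpace Ubar]
  {i : V →L[ℝ] H} {e : HilbertBasis ℕ ℝ U}

/-- The measurability assumptions on the coefficients `b` and `σ`. -/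
structure CoefficientsMeasurable [MeasurableSpace E] (b : ℝ≥0 → PathSpace i → E)
    (σ : ℝ≥0 → PathSpace i → HilbertSchmidt H e) : Prop where
  measurable_drift : Measurable (fun p : ℝ≥0 × PathSpace i => b p.1 p.2)
  adapted_drift : ∀ t, Measurable[PathSpace.upTo i t] (b t)
  measurable_diffusion : Measurable (fun p : ℝ≥0 × PathSpace i => σ p.1 p.2)
  adapted_diffusion : ∀ t, Measurable[PathSpace.upTo i t] (σ t)

/-- `(X, W)` is a weak solution on the stochastic basis `(Ω, 𝓕, (𝓕ₜ), P)`. The equation holds in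
`E`, with a pathwise Bochner integral and an `H`-valued stochastic integral. -/
structure IsWeakSolution (j : H →L[ℝ] E) (J : U →L[ℝ] Ubar) (b : ℝ≥0 → PathSpace i → E)
    (σ : ℝ≥0 → PathSpace i → HilbertSchmidt H e)
    {Ω : Type u} {mΩ : MeasurableSpace Ω} (𝓕 : Filtration ℝ≥0 mΩ) (P : Measure Ω)
    (X : Ω → PathSpace i) (W : WienerProcess e J 𝓕 P) : Prop where
  isStochasticBasis : IsStochasticBasis 𝓕 P
  measurable : Measurable X
  adapted : ∀ t, Measurable[𝓕 t] (fun ω => X ω t)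
  integrable : ∀ T : ℝ≥0, ∀ᵐ ω ∂P,
    (∫⁻ s in Set.Iic T, ‖b s (X ω)‖ₑ ∂lebesgueNN) + (∫⁻ s in Set.Iic T, ‖σ s (X ω)‖ₑ ^ 2 ∂lebesgueNN) < ∞
  equation : ∃ I : ℝ≥0 → Ω → H, IsStochasticIntegral W (fun s ω => (σ s (X ω)).toCLM) I ∧
    ∀ᵐ ω ∂P, ∀ t, j (X ω t) = j (X ω 0) + (∫ s in Set.Iic t, b s (X ω) ∂lebesgueNN) + j (I t ω)

/-- Joint uniqueness in law given `μ`. -/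
def JointUniquenessInLawGiven (j : H →L[ℝ] E) (J : U →L[ℝ] Ubar) (b : ℝ≥0 → PathSpace i → E)
    (σ : ℝ≥0 → PathSpace i → HilbertSchmidt H e) (μ : Measure H) : Prop :=
  ∀ (Ω Ω' : Type u) (mΩ : MeasurableSpace Ω) (mΩ' : MeasurableSpace Ω')
    (𝓕 : Filtration ℝ≥0 mΩ) (𝓕' : Filtration ℝ≥0 mΩ') (P : Measure Ω) (P' : Measure Ω')
    (X : Ω → PathSpace i) (W₁ : WienerProcess e J 𝓕 P)
    (Y : Ω' → PathSpace i) (W₂ : WienerProcess e J 𝓕' P'),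
    IsWeakSolution j J b σ 𝓕 P X W₁ → IsWeakSolution j J b σ 𝓕' P' Y W₂ →
    P.map (fun ω => X ω 0) = μ → P'.map (fun ω => Y ω 0) = μ →
    P.map (fun ω => (X ω, W₁.bar ω)) = P'.map (fun ω => (Y ω, W₂.bar ω))

/-- Joint uniqueness in law. -/
def JointUniquenessInLaw (j : H →L[ℝ] E) (J : U →L[ℝ] Ubar) (b : ℝ≥0 → PathSpace i → E)
    (σ : ℝ≥0 → PathSpace i → HilbertSchmidt H e) : Prop :=
  ∀ (Ω Ω' : Type u) (mΩ : MeasurableSpace Ω) (mΩ' : MeasurableSpace Ω')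
    (𝓕 : Filtration ℝ≥0 mΩ) (𝓕' : Filtration ℝ≥0 mΩ') (P : Measure Ω) (P' : Measure Ω')
    (X : Ω → PathSpace i) (W₁ : WienerProcess e J 𝓕 P)
    (Y : Ω' → PathSpace i) (W₂ : WienerProcess e J 𝓕' P'),
    IsWeakSolution j J b σ 𝓕 P X W₁ → IsWeakSolution j J b σ 𝓕' P' Y W₂ →
    P.map (fun ω => X ω 0) = P'.map (fun ω => Y ω 0) →
    P.map (fun ω => (X ω, W₁.bar ω)) = P'.map (fun ω => (Y ω, W₂.bar ω))

/-- Pathwise uniqueness given `μ`. -/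
def PathwiseUniquenessGiven (j : H →L[ℝ] E) (J : U →L[ℝ] Ubar) (b : ℝ≥0 → PathSpace i → E)
    (σ : ℝ≥0 → PathSpace i → HilbertSchmidt H e) (μ : Measure H) : Prop :=
  ∀ (Ω : Type u) (mΩ : MeasurableSpace Ω) (𝓕 : Filtration ℝ≥0 mΩ) (P : Measure Ω)
    (X Y : Ω → PathSpace i) (W : WienerProcess e J 𝓕 P),
    IsWeakSolution j J b σ 𝓕 P X W → IsWeakSolution j J b σ 𝓕 P Y W →
    P.map (fun ω => X ω 0) = μ → P.map (fun ω => Y ω 0) = μ →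
    (∀ᵐ ω ∂P, X ω 0 = Y ω 0) → ∀ᵐ ω ∂P, ∀ t, X ω t = Y ω t

/-- Pathwise uniqueness. -/
def PathwiseUniqueness (j : H →L[ℝ] E) (J : U →L[ℝ] Ubar) (b : ℝ≥0 → PathSpace i → E)
    (σ : ℝ≥0 → PathSpace i → HilbertSchmidt H e) : Prop :=
  ∀ (Ω : Type u) (mΩ : MeasurableSpace Ω) (𝓕 : Filtration ℝ≥0 mΩ) (P : Measure Ω)
    (X Y : Ω → PathSpace i) (W : WienerProcess e J 𝓕 P),
    IsWeakSolution j J b σ 𝓕 P X W → IsWeakSolution j J b σ 𝓕 P Y W →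
    (∀ᵐ ω ∂P, X ω 0 = Y ω 0) → ∀ᵐ ω ∂P, ∀ t, X ω t = Y ω t

/-- `F : H × 𝕎₀ → 𝔹` belongs to the class `Ê` (with respect to the law `ν` of `W̄`), as witnessed
by the maps `Fm μ`: for every probability measure `μ` on `H`, `Fm μ` is measurable with respect to
the completion of the Borel σ-algebra under `μ ⊗ ν`, and for `μ`-almost all `h`,
`F(h, w) = Fm μ (h, w)` for `ν`-almost all `w`. -/
def IsInClassE (ν : Measure (WienerSpace Ubar)) (F : H → WienerSpace Ubar → PathSpace i)
    (Fm : Measure H → H × WienerSpace Ubar → PathSpace i) : Prop :=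
  ∀ μ : Measure H, IsProbabilityMeasure μ →
    NullMeasurable (Fm μ) (μ.prod ν) ∧ ∀ᵐ h ∂μ, ∀ᵐ w ∂ν, F h w = Fm μ (h, w)

/-- The equation has a strong solution `F`. The measure `ν` is the law of `W̄`; in the second
condition the σ-algebra of `𝕎₀` up to time `t` is completed by the `ν`-null sets. -/
def HasStrongSolution (j : H →L[ℝ] E) (J : U →L[ℝ] Ubar) (b : ℝ≥0 → PathSpace i → E)
    (σ : ℝ≥0 → PathSpace i → HilbertSchmidt H e) : Prop :=
  ∃ (F : H → WienerSpace Ubar → PathSpace i)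
    (Fm : Measure H → H × WienerSpace Ubar → PathSpace i),
    (∀ ν : Measure (WienerSpace Ubar), IsWienerLaw.{u} e J ν →
      IsInClassE ν F Fm ∧
      ∀ (h : H) (t : ℝ≥0),
        @Measurable _ _ (eventuallyMeasurableSpace (WienerSpace.upTo Ubar t) (ae ν))
          (PathSpace.upTo i t) (F h)) ∧
    ∀ (Ω : Type u) (mΩ : MeasurableSpace Ω) (𝓕 : Filtration ℝ≥0 mΩ) (P : Measure Ω)
      (W : WienerProcess e J 𝓕 P) (ξ : Ω → H),
      IsStochasticBasis 𝓕 P → Measurable[𝓕 0] ξ →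
      IsWeakSolution j J b σ 𝓕 P (fun ω => Fm (P.map ξ) (ξ ω, W.bar ω)) W ∧
      ∀ᵐ ω ∂P, Fm (P.map ξ) (ξ ω, W.bar ω) 0 = ξ ω

end Equation

/-!
Let `(X, W)` be a weak solution whose initial value has law `μ`, and put
`Z = F_μ(X₀, W̄)`. By the definition of a strong solution, `(Z, W)` is a weak solution on the same
stochastic basis with `Z₀ = X₀` almost surely, so joint uniqueness in law given `μ` says that
`(Z, W̄)` and `(X, W̄)` have the same law. The property of being the image of the initial value and
the driving path under `F_μ` is a property of that joint law. It holds for `Z` by construction, and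
therefore `X = F_μ(X₀, W̄)` almost surely
(`IsWeakSolution.ae_eq_strongSolution`). If `(Y, W)` is another weak solution with the same `W` and
with `Y₀ = X₀`, then `Y = F_μ(Y₀, W̄) = F_μ(X₀, W̄) = X` almost surely.

The delicate point is measurability: `F_μ` is only measurable with respect to the completion of the
product σ-algebra under `μ ⊗ ν`, where `ν` is the law of `W̄`. To replace `F_μ` by a Borel version
along `(X₀, W̄)`, the law of `(X₀, W̄)` has to be `μ ⊗ ν`, that is, `X₀` and `W̄` have to be
independent (`WienerProcess.indepFun_bar`). This follows from the independence of each increment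
from the past, by induction on the number of times (`indep_iSup_comap_of_indep_increments`), and
from the fact that the Borel σ-algebra of `𝕎₀` is generated by the evaluations
(`WienerSpace.measurableSpace_le_comap_eval`). The Borel version is taken of `F_μ(·)(t)` for one
time `t` at a time, so that measurability of the evaluations is all that is needed of `𝔹`.
-/

/-! ### Measurability in the path spaces -/

section PathSpaces

variable {V H Ubar : Type*}
  [NormedAddCommGroup V] [NormedSpace ℝ V]
  [NormedAddCommGroup H] [InnerProductSpace ℝ H]
  [NormedAddCommGroup Ubar] {i : V →L[ℝ] H}

theorem PathSpace.enorm_sub_le_rho (x y : PathSpace i) {t : ℝ≥0} {k : ℕ} (htk : t ≤ k + 1) :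
    (2 : ℝ≥0∞)⁻¹ ^ (k + 1) * min ‖y t - x t‖ₑ 1 ≤ PathSpace.rho x y := by
  refine le_trans ?_ (ENNReal.le_tsum k)
  gcongr
  refine le_trans ?_ le_add_self
  exact le_iSup₂ (f := fun s (_ : s ∈ Set.Iic ((k : ℝ≥0) + 1)) => ‖y s - x s‖ₑ) t htk

theorem PathSpace.continuous_eval (t : ℝ≥0) : Continuous (fun x : PathSpace i => x t) := by
  refine ⟨fun S hS x hx => ?_⟩
  obtain ⟨ε, hε, hball⟩ := EMetric.isOpen_iff.1 hS (x t) hx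
  obtain ⟨k, hk⟩ := exists_nat_ge t
  have h2 : (2 : ℝ≥0∞)⁻¹ ^ (k + 1) ≠ 0 := pow_ne_zero _ (by simp)
  refine ⟨(2 : ℝ≥0∞)⁻¹ ^ (k + 1) * min ε 1, ENNReal.mul_pos h2 (by simp [hε.ne']),
    fun y hy => hball ?_⟩
  have h3 := (PathSpace.enorm_sub_le_rho x y (hk.trans le_self_add)).trans_lt hy
  have h4 : min ‖y t - x t‖ₑ 1 < min ε 1 := lt_of_mul_lt_mul_left' h3
  rw [Metric.mem_eball, edist_eq_enorm_sub]
  by_contra hcon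
  exact absurd h4 (not_lt.2 (min_le_min_right 1 (not_lt.1 hcon)))

theorem PathSpace.measurable_eval [MeasurableSpace H] [BorelSpace H] (t : ℝ≥0) :
    Measurable (fun x : PathSpace i => x t) :=
  (PathSpace.continuous_eval t).measurable

/-- A continuous path maps a compact set `K` into an open set `O` if and only if its distance to
the complement of `O` is bounded below along a countable dense subset of `K`. -/
theorem ContinuousMap.measurableSet_mapsTo [MeasurableSpace Ubar] [BorelSpace Ubar]
    {K : Set ℝ≥0} (hK : IsCompact K) {O : Set Ubar} (hO : IsOpen O) :
    MeasurableSet[MeasurableSpace.pi.comap (fun (f : C(ℝ≥0, Ubar)) (t : ℝ≥0) => f t)]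
      {f : C(ℝ≥0, Ubar) | Set.MapsTo f K O} := by
  obtain ⟨D, hDK, hD, hKD⟩ :=
    (TopologicalSpace.IsSeparable.of_separableSpace K).exists_countable_dense_subset
  have key : {f : C(ℝ≥0, Ubar) | Set.MapsTo f K O} = ⋃ n : ℕ, ⋂ d ∈ D,
      (fun (f : C(ℝ≥0, Ubar)) (t : ℝ≥0) => f t) ⁻¹'
        {g | (n : ℝ≥0∞)⁻¹ ≤ Metric.infEDist (g d) Oᶜ} := by
    ext f
    simp only [Set.mem_ofPred_eq, Set.mem_iUnion, Set.mem_iInter, Set.mem_preimage]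
    have hcont : Continuous fun t => Metric.infEDist (f t) Oᶜ :=
      Metric.continuous_infEDist.comp f.continuous
    constructor
    · intro hf
      rcases K.eq_empty_or_nonempty with rfl | hne
      · exact ⟨0, fun d hd => absurd (hDK hd) (by simp)⟩
      obtain ⟨x, hx, hmin⟩ := hK.exists_isMinOn hne hcont.continuousOn
      have hpos : Metric.infEDist (f x) Oᶜ ≠ 0 := by
        rw [Ne, ← Metric.mem_closure_iff_infEDist_zero, hO.isClosed_compl.closure_eq]
        exact fun h => h (hf hx)
      obtain ⟨n, hn⟩ := ENNReal.exists_inv_nat_lt hpos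
      exact ⟨n, fun d hd => hn.le.trans (hmin (hDK hd))⟩
    · rintro ⟨n, hn⟩ x hx
      have h1 : x ∈ {t | (n : ℝ≥0∞)⁻¹ ≤ Metric.infEDist (f t) Oᶜ} :=
        closure_minimal (s := D) hn (isClosed_le continuous_const hcont) (hKD hx)
      by_contra hxO
      have h2 : Metric.infEDist (f x) Oᶜ = 0 := Metric.infEDist_zero_of_mem hxO
      simp [h2] at h1
  rw [key]
  refine MeasurableSet.iUnion fun n => MeasurableSet.biInter hD fun d _ => ⟨_, ?_, rfl⟩
  exact measurableSet_le measurable_const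
    (measurable_infEDist.comp (measurable_pi_apply d))

/-- The Borel σ-algebra of `𝕎₀` is generated by the evaluations (the nontrivial inclusion). -/
theorem WienerSpace.measurableSpace_le_comap_eval [SecondCountableTopology Ubar]
    [MeasurableSpace Ubar] [BorelSpace Ubar] :
    (inferInstance : MeasurableSpace (WienerSpace Ubar)) ≤
      MeasurableSpace.pi.comap (fun (w : WienerSpace Ubar) (t : ℝ≥0) => w t) := by
  have h1 : borel C(ℝ≥0, Ubar) ≤
      MeasurableSpace.pi.comap (fun (f : C(ℝ≥0, Ubar)) (t : ℝ≥0) => f t) := by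
    rw [borel_eq_generateFrom_of_subbasis ContinuousMap.compactOpen_eq]
    refine MeasurableSpace.generateFrom_le ?_
    rintro _ ⟨K, hK, O, hO, rfl⟩
    exact ContinuousMap.measurableSet_mapsTo hK hO
  have h2 : (inferInstance : MeasurableSpace (WienerSpace Ubar)) =
      (borel C(ℝ≥0, Ubar)).comap Subtype.val :=
    borel_comap (α := WienerSpace Ubar) (f := Subtype.val) (t := inferInstance)
  rw [h2]
  refine (MeasurableSpace.comap_mono h1).trans ?_
  rw [MeasurableSpace.comap_comp]
  rfl

end PathSpaces

/-! ### Independence of the initial information and the Wiener process -/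

section Independence

variable {Ω : Type*} {mΩ : MeasurableSpace Ω} {P : Measure Ω}

/-- If `m₀` is independent of `m₁`, and `m₂` is independent of both together, then `m₀` is
independent of `m₁` and `m₂` together. -/
theorem ProbabilityTheory.Indep.sup_right_of_sup_left [IsProbabilityMeasure P]
    {m₀ m₁ m₂ : MeasurableSpace Ω} (h₀ : m₀ ≤ mΩ) (h₁ : m₁ ≤ mΩ) (h₂ : m₂ ≤ mΩ)
    (h : Indep m₀ m₁ P) (h' : Indep (m₀ ⊔ m₁) m₂ P) : Indep m₀ (m₁ ⊔ m₂) P := by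
  have hgen : m₁ ⊔ m₂ = MeasurableSpace.generateFrom
      (Set.image2 (· ∩ ·) {s | MeasurableSet[m₁] s} {s | MeasurableSet[m₂] s}) := by
    refine le_antisymm (sup_le ?_ ?_) (MeasurableSpace.generateFrom_le ?_)
    · exact fun s hs => MeasurableSpace.measurableSet_generateFrom
        ⟨s, hs, Set.univ, MeasurableSet.univ, Set.inter_univ s⟩
    · exact fun s hs => MeasurableSpace.measurableSet_generateFrom
        ⟨Set.univ, MeasurableSet.univ, s, hs, Set.univ_inter s⟩
    · rintro _ ⟨s, hs, t, ht, rfl⟩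
      exact MeasurableSet.inter ((le_sup_left : m₁ ≤ m₁ ⊔ m₂) s hs)
        ((le_sup_right : m₂ ≤ m₁ ⊔ m₂) t ht)
  refine IndepSets.indep h₀ (sup_le h₁ h₂) (@MeasurableSpace.isPiSystem_measurableSet Ω m₀) ?_
    (@MeasurableSpace.generateFrom_measurableSet Ω m₀).symm hgen ?_
  · rintro _ ⟨s, hs, t, ht, rfl⟩ _ ⟨s', hs', t', ht', rfl⟩ -
    exact ⟨s ∩ s', MeasurableSet.inter hs hs', t ∩ t', MeasurableSet.inter ht ht',
      Set.inter_inter_inter_comm _ _ _ _⟩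
  · rw [IndepSets_iff]
    rintro a _ ha ⟨s, hs, t, ht, rfl⟩
    rw [Indep_iff] at h h'
    have hs' := (le_sup_right : m₁ ≤ m₀ ⊔ m₁) s hs
    have has := MeasurableSet.inter ((le_sup_left : m₀ ≤ m₀ ⊔ m₁) a ha) hs'
    rw [← Set.inter_assoc, h' _ _ has ht, h' _ _ hs' ht, h _ _ ha hs, mul_assoc]

/-- If the increments of an adapted process `V` with `V 0 = 0` are independent of the past, then
finitely many values of `V` are jointly independent of the σ-algebra at time `0`. -/
theorem indep_iSup_comap_of_indep_increments [IsProbabilityMeasure P] {𝓕 : Filtration ℝ≥0 mΩ}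
    {V : ℝ≥0 → Ω → ℕ → ℝ} (hV : ∀ t, Measurable[𝓕 t] (V t)) (hV0 : ∀ ω, V 0 ω = 0)
    (hind : ∀ s t, s ≤ t →
      Indep (MeasurableSpace.comap (fun ω => V t ω - V s ω) inferInstance) (𝓕 s) P)
    (I : Finset ℝ≥0) :
    Indep (𝓕 0) (⨆ t ∈ I, MeasurableSpace.comap (V t) inferInstance) P := by
  induction I using Finset.induction_on_max with
  | empty => simpa using indep_bot_right (𝓕 0)
  | insert a I ha ih =>
    set m := ⨆ t ∈ I, MeasurableSpace.comap (V t) inferInstance with hm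
    -- The increment over `(s, a]` determines `V a` together with the earlier values,
    -- where `s` is the last time in `I`, or `0` if there is none.
    obtain ⟨s, hsa, hIs, hs⟩ : ∃ s ≤ a, (∀ t ∈ I, t ≤ s) ∧ Measurable[m] (V s) := by
      rcases I.eq_empty_or_nonempty with rfl | hne
      · refine ⟨0, zero_le, by simp, ?_⟩
        rw [show V 0 = fun _ => 0 from funext hV0]
        exact measurable_const
      · refine ⟨I.max' hne, (ha _ (I.max'_mem hne)).le, fun t ht => I.le_max' t ht, ?_⟩
        rw [measurable_iff_comap_le]
        exact le_iSup₂ (f := fun t (_ : t ∈ I) => MeasurableSpace.comap (V t) inferInstance) _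
          (I.max'_mem hne)
    have hmF : m ≤ 𝓕 s := iSup₂_le fun t ht =>
      ((hV t).mono (𝓕.mono (hIs t ht)) le_rfl).comap_le
    have hZ : Measurable[mΩ] fun ω => V a ω - V s ω :=
      ((hV a).mono (𝓕.le a) le_rfl).sub ((hV s).mono (𝓕.le s) le_rfl)
    have hstep := ih.sup_right_of_sup_left (𝓕.le 0) (hmF.trans (𝓕.le s)) hZ.comap_le
      (indep_of_indep_of_le_left (hind s a hsa).symm (sup_le (𝓕.mono zero_le) hmF))
    refine indep_of_indep_of_le_right hstep (iSup₂_le fun t ht => ?_)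
    rcases Finset.mem_insert.1 ht with rfl | ht
    · rw [← measurable_iff_comap_le]
      have h1 := hs.mono (le_sup_left : m ≤ m ⊔
        MeasurableSpace.comap (fun ω => V t ω - V s ω) inferInstance) le_rfl
      have h2 := (comap_measurable fun ω => V t ω - V s ω).mono (le_sup_right : _ ≤ m ⊔
        MeasurableSpace.comap (fun ω => V t ω - V s ω) inferInstance) le_rfl
      simpa only [Pi.add_def, add_sub_cancel] using h1.add h2
    · exact (le_iSup₂ (f := fun t (_ : t ∈ I) => MeasurableSpace.comap (V t) inferInstance)
        t ht).trans le_sup_left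

end Independence

namespace WienerProcess

variable {U H Ubar : Type*}
  [NormedAddCommGroup U] [InnerProductSpace ℝ U]
  [NormedAddCommGroup Ubar] [InnerProductSpace ℝ Ubar]
  {e : HilbertBasis ℕ ℝ U} {J : U →L[ℝ] Ubar}
  {Ω : Type u} {mΩ : MeasurableSpace Ω} {𝓕 : Filtration ℝ≥0 mΩ} {P : Measure Ω}

/-- The value of `W̄ₜ` as a function of the coordinates `(βₖ(t))ₖ`; where the series
`∑ₖ xₖ J eₖ` diverges, the value is arbitrary. -/
noncomputable def series (e : HilbertBasis ℕ ℝ U) (J : U →L[ℝ] Ubar) (x : ℕ → ℝ) : Ubar :=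
  limUnder atTop fun n => ∑ k ∈ Finset.range n, x k • J (e k)

theorem ae_bar_eq_series (W : WienerProcess e J 𝓕 P) (t : ℝ≥0) :
    ∀ᵐ ω ∂P, series e J (fun k => W.coord k t ω - W.coord k 0 ω) = W.bar ω t := by
  have h0 : ∀ᵐ ω ∂P, ∀ k, W.coord k 0 ω = 0 :=
    ae_all_iff.2 fun k => (W.isBrownian k).eval_zero_ae_eq_zero
  filter_upwards [h0, W.tendsto_bar t] with ω h0 h
  simp only [h0, sub_zero]
  exact h.limUnder_eq

variable [CompleteSpace Ubar] [SecondCountableTopology Ubar] [MeasurableSpace Ubar]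
  [BorelSpace Ubar]

theorem measurable_series : Measurable (series e J) := by
  refine (StronglyMeasurable.limUnder fun n => Measurable.stronglyMeasurable ?_).measurable
  exact Finset.measurable_sum _ fun k _ => (measurable_pi_apply k).smul_const _

theorem measurable_bar (W : WienerProcess e J 𝓕 P) [P.IsComplete] : Measurable W.bar := by
  have h : ∀ t, Measurable fun ω => W.bar ω t := fun t => by
    have h1 : Measurable fun ω => series e J (fun k => W.coord k t ω - W.coord k 0 ω) :=
      measurable_series.comp <| measurable_pi_lambda _ fun k =>
        ((W.adapted k t).mono (𝓕.le t) le_rfl).sub ((W.adapted k 0).mono (𝓕.le 0) le_rfl)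
    exact aemeasurable_iff_measurable.1 (h1.aemeasurable.congr (W.ae_bar_eq_series t))
  have h' : Measurable fun ω (t : ℝ≥0) => W.bar ω t := measurable_pi_lambda _ h
  refine Measurable.mono (fun s hs => ?_) le_rfl WienerSpace.measurableSpace_le_comap_eval
  obtain ⟨s, hs, rfl⟩ := hs
  exact h' hs

theorem indepFun_bar [MeasurableSpace H] (W : WienerProcess e J 𝓕 P)
    (hP : IsStochasticBasis 𝓕 P) {ξ : Ω → H} (hξ : Measurable[𝓕 0] ξ) :
    IndepFun ξ W.bar P := by
  have := hP.isProbabilityMeasure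
  have := hP.isComplete
  -- `βₖ(0)` vanishes only almost surely, so it is subtracted to get a process that starts at `0`.
  set B : ℝ≥0 → Ω → ℕ → ℝ := fun t ω k => W.coord k t ω - W.coord k 0 ω with hB
  have hBm : ∀ t, Measurable[𝓕 t] (B t) := fun t => by
    refine @measurable_pi_lambda _ _ _ (𝓕 t) _ _ fun k => ?_
    exact (W.adapted k t).sub ((W.adapted k 0).mono (𝓕.mono zero_le) le_rfl)
  have hfin := indep_iSup_comap_of_indep_increments (P := P) hBm (fun ω => by ext; simp [hB])
    (fun s t hst => by
      have : (fun ω => B t ω - B s ω) = fun ω k => W.coord k t ω - W.coord k s ω := by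
        ext ω k
        simp [hB]
      rw [this]
      exact W.indep_increments s t hst)
  have hproc : IndepFun ξ (fun ω t => series e J (B t ω)) P := by
    refine IndepFun.indepFun_process (hξ.mono (𝓕.le 0) le_rfl)
      (fun t => measurable_series.comp ((hBm t).mono (𝓕.le t) le_rfl)) fun I => ?_
    refine indep_of_indep_of_le_left (indep_of_indep_of_le_right (hfin I) ?_) hξ.comap_le
    rw [← measurable_iff_comap_le]
    refine @measurable_pi_lambda _ _ _ (_) _ _ fun t => measurable_series.comp ?_
    rw [measurable_iff_comap_le]
    exact le_iSup₂ (f := fun t (_ : t ∈ I) => MeasurableSpace.comap (B t) inferInstance) _ t.2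
  have hbar : IndepFun ξ (fun ω (t : ℝ≥0) => W.bar ω t) P :=
    hproc.process_congr_right W.ae_bar_eq_series
  refine indep_of_indep_of_le_right hbar ?_
  refine (MeasurableSpace.comap_mono WienerSpace.measurableSpace_le_comap_eval).trans ?_
  rw [MeasurableSpace.comap_comp]
  rfl

end WienerProcess

/-! ### Weak solutions are images of the driving noise under the strong solution -/

section Uniqueness

variable {V H E U Ubar : Type*}
  [NormedAddCommGroup V] [NormedSpace ℝ V]
  [NormedAddCommGroup H] [InnerProductSpace ℝ H] [SecondCountableTopology H]
  [MeasurableSpace H] [BorelSpace H]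
  [NormedAddCommGroup E] [NormedSpace ℝ E]
  [NormedAddCommGroup U] [InnerProductSpace ℝ U]
  [NormedAddCommGroup Ubar] [InnerProductSpace ℝ Ubar] [CompleteSpace Ubar]
  [SecondCountableTopology Ubar] [MeasurableSpace Ubar] [BorelSpace Ubar]
  {i : V →L[ℝ] H} {j : H →L[ℝ] E} {e : HilbertBasis ℕ ℝ U} {J : U →L[ℝ] Ubar}
  {b : ℝ≥0 → PathSpace i → E} {σ : ℝ≥0 → PathSpace i → HilbertSchmidt H e}
  {Ω : Type u} {mΩ : MeasurableSpace Ω} {𝓕 : Filtration ℝ≥0 mΩ} {P : Measure Ω}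
  {X : Ω → PathSpace i} {W : WienerProcess e J 𝓕 P}

/-- Suppose that `G` applied to the initial value and the noise of the weak solution `(X, W)` is
again a weak solution with the same initial value. Under joint uniqueness in law, it is `X`. -/
theorem IsWeakSolution.ae_eq_strongSolution {μ : Measure H}
    (hunique : JointUniquenessInLawGiven.{u} j J b σ μ) (hX : IsWeakSolution j J b σ 𝓕 P X W)
    (hμ : P.map (fun ω => X ω 0) = μ) {G : H × WienerSpace Ubar → PathSpace i}
    (hG : NullMeasurable G (μ.prod (P.map W.bar)))
    (hZ : IsWeakSolution j J b σ 𝓕 P (fun ω => G (X ω 0, W.bar ω)) W)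
    (hZ0 : ∀ᵐ ω ∂P, G (X ω 0, W.bar ω) 0 = X ω 0) :
    ∀ᵐ ω ∂P, ∀ t, X ω t = G (X ω 0, W.bar ω) t := by
  have := hX.isStochasticBasis.isProbabilityMeasure
  have := hX.isStochasticBasis.isComplete
  have hX0 : Measurable fun ω => X ω 0 := (PathSpace.measurable_eval 0).comp hX.measurable
  have hbar : Measurable W.bar := W.measurable_bar
  have hlaw : P.map (fun ω => (X ω 0, W.bar ω)) = μ.prod (P.map W.bar) := by
    rw [← hμ]
    exact (W.indepFun_bar hX.isStochasticBasis (hX.adapted 0)).map_prod_eq_prod_map_map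
      hX0.aemeasurable hbar.aemeasurable
  have hjoint := hunique Ω Ω mΩ mΩ 𝓕 𝓕 P P _ W X W hZ hX
    ((Measure.map_congr hZ0).trans hμ) hμ
  have hpt : ∀ t : ℝ≥0, ∀ᵐ ω ∂P, X ω t = G (X ω 0, W.bar ω) t := fun t => by
    obtain ⟨g, hg, hGg⟩ : AEMeasurable (fun p => G p t) (μ.prod (P.map W.bar)) :=
      NullMeasurable.aemeasurable fun s hs => hG (PathSpace.measurable_eval t hs)
    have hver : ∀ᵐ ω ∂P, G (X ω 0, W.bar ω) t = g (X ω 0, W.bar ω) := by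
      rw [← hlaw] at hGg
      exact ae_of_ae_map (hX0.prodMk hbar).aemeasurable hGg
    have hset : MeasurableSet {p : PathSpace i × WienerSpace Ubar |
        p.1 t = g (p.1 0, p.2)} :=
      measurableSet_eq_fun ((PathSpace.measurable_eval t).comp measurable_fst)
        (hg.comp
          (((PathSpace.measurable_eval 0).comp measurable_fst).prodMk measurable_snd))
    have hGlaw : ∀ᵐ p ∂P.map (fun ω => (G (X ω 0, W.bar ω), W.bar ω)),
        p.1 t = g (p.1 0, p.2) := by
      rw [ae_map_iff (hZ.measurable.prodMk hbar).aemeasurable hset]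
      filter_upwards [hver, hZ0] with ω h1 h2
      rw [h2, h1]
    rw [hjoint] at hGlaw
    filter_upwards [ae_of_ae_map (hX.measurable.prodMk hbar).aemeasurable hGlaw, hver]
      with ω h1 h2
    exact h1.trans h2.symm
  filter_upwards [ae_all_iff.2 fun n => hpt (TopologicalSpace.denseSeq ℝ≥0 n)] with ω h
  exact congrFun (Continuous.ext_on (TopologicalSpace.denseRange_denseSeq ℝ≥0)
    (X ω).1.continuous (G (X ω 0, W.bar ω)).1.continuous (Set.forall_mem_range.2 h))

theorem HasStrongSolution.pathwiseUniquenessGiven (hstrong : HasStrongSolution.{u} j J b σ)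
    (μ : Measure H) (hunique : JointUniquenessInLawGiven.{u} j J b σ μ) :
    PathwiseUniquenessGiven.{u} j J b σ μ := by
  obtain ⟨F, Fm, hclass, hsol⟩ := hstrong
  have key : ∀ (Ω : Type u) (mΩ : MeasurableSpace Ω) (𝓕 : Filtration ℝ≥0 mΩ) (P : Measure Ω)
      (X : Ω → PathSpace i) (W : WienerProcess e J 𝓕 P), IsWeakSolution j J b σ 𝓕 P X W →
      P.map (fun ω => X ω 0) = μ → ∀ᵐ ω ∂P, ∀ t, X ω t = Fm μ (X ω 0, W.bar ω) t := by
    intro Ω mΩ 𝓕 P X W hX hμ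
    have := hX.isStochasticBasis.isProbabilityMeasure
    have hX0 : Measurable fun ω => X ω 0 := (PathSpace.measurable_eval 0).comp hX.measurable
    have hμ' : IsProbabilityMeasure μ := hμ ▸ Measure.isProbabilityMeasure_map hX0.aemeasurable
    obtain ⟨hZ, hZ0⟩ := hsol Ω mΩ 𝓕 P W (fun ω => X ω 0) hX.isStochasticBasis (hX.adapted 0)
    rw [hμ] at hZ hZ0
    exact hX.ae_eq_strongSolution hunique hμ
      ((hclass _ ⟨Ω, mΩ, 𝓕, P, W, hX.isStochasticBasis, rfl⟩).1 μ hμ').1 hZ hZ0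
  intro Ω mΩ 𝓕 P X Y W hX hY hμX hμY hXY
  filter_upwards [key Ω mΩ 𝓕 P X W hX hμX, key Ω mΩ 𝓕 P Y W hY hμY, hXY] with ω h1 h2 h3 t
  rw [h1, h2, h3]

end Uniqueness

theorem theorem1
    {V H E U Ubar : Type*}
    [NormedAddCommGroup V] [NormedSpace ℝ V] [CompleteSpace V] [SecondCountableTopology V]
    [NormedAddCommGroup H] [InnerProductSpace ℝ H] [CompleteSpace H] [SecondCountableTopology H]
    [MeasurableSpace H] [BorelSpace H]
    [NormedAddCommGroup E] [NormedSpace ℝ E] [CompleteSpace E] [SecondCountableTopology E]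
    [MeasurableSpace E] [BorelSpace E]
    [NormedAddCommGroup U] [InnerProductSpace ℝ U] [CompleteSpace U]
    [NormedAddCommGroup Ubar] [InnerProductSpace ℝ Ubar] [CompleteSpace Ubar]
    [SecondCountableTopology Ubar] [MeasurableSpace Ubar] [BorelSpace Ubar]
    (i : V →L[ℝ] H) (j : H →L[ℝ] E) (hij : IsGelfandTriple i j)
    (e : HilbertBasis ℕ ℝ U)
    (J : U →L[ℝ] Ubar) (hJ : Function.Injective J) (hJ' : hsNormSq e J < ∞)
    (b : ℝ≥0 → PathSpace i → E) (σ : ℝ≥0 → PathSpace i → HilbertSchmidt H e)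
    (hbσ : CoefficientsMeasurable b σ)
    (hstrong : HasStrongSolution.{u} j J b σ) :
    (∀ μ : Measure H, IsProbabilityMeasure μ →
      JointUniquenessInLawGiven.{u} j J b σ μ → PathwiseUniquenessGiven.{u} j J b σ μ) ∧
    (JointUniquenessInLaw.{u} j J b σ → PathwiseUniqueness.{u} j J b σ) := by
  refine ⟨fun μ _ => hstrong.pathwiseUniquenessGiven μ, ?_⟩
  intro hunique Ω mΩ 𝓕 P X Y W hX hY hXY
  refine hstrong.pathwiseUniquenessGiven (P.map fun ω => X ω 0) ?_ Ω mΩ 𝓕 P X Y W hX hY rfl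
    (Measure.map_congr hXY).symm hXY
  intro Ω₁ Ω₂ mΩ₁ mΩ₂ 𝓕₁ 𝓕₂ P₁ P₂ X₁ W₁ X₂ W₂ h₁ h₂ hμ₁ hμ₂
  exact hunique Ω₁ Ω₂ mΩ₁ mΩ₂ 𝓕₁ 𝓕₂ P₁ P₂ X₁ W₁ X₂ W₂ h₁ h₂ (hμ₁.trans hμ₂.symm)
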